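/- Let $d,k\ge 1$ be integers, $\alpha>1$ and $\Delta>0$ real. For distributions $P,Q$ on a common measurable space let $D_\alpha(P,Q)=\frac{1}{\alpha-1}\log \mathbb{E}_{x\sim Q}\big[(\tfrac{dP}{dQ}(x))^\alpha\big]\in[0,+\infty]$ be the Rényi divergence of order $\alpha$ (equal to $+\infty$ if $P\not\ll Q$), and write $D_\alpha(X,Y)$ for the divergence between the laws of random variables $X,Y$. For deterministic $v,w\in\mathbb{R}^{d\times k}$ let $V=v+N$ and $W=w+N$ denote the Gaussian perturbations of $v$ and $w$, where $N\in\mathbb{R}^{d\times k}$ has i.i.d. standard normal entries. **Proposition (No worst-case amplification in the $n_{\mathrm{syn}}\to\infty$ regime).** Without any bound on the size of the parameters, \[ \sup_{v,w\in\mathbb{R}^{d\times k},\ \|v-w\|_F\le\Delta} D_\alpha(V^\top V,W^\top W)\;=\;\sup_{v,w\in\mathbb{R}^{d\times k},\ \|v-w\|_F\le\Delta} D_\alpha(V,W), \] and this common value equals $D_\alpha(V_0,W_0)$ for every pair $v_0,w_0\in\mathbb{R}^{d\times k}$ with $\|v_0-w_0\|_F=\Delta$, where $V_0=v_0+N$ and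 $W_0=w_0+N$. That is, releasing the Gram matrix (which corresponds to an infinite synthetic data release) is in the worst case no more private than releasing the perturbed parameter itself. -/

import Mathlib

open MeasureTheory ProbabilityTheory
open scoped Matrix

attribute [local instance] Matrix.frobeniusNormedAddCommGroup

/-- The product (equivalently, Borel) σ-algebra on matrices. -/
instance matrixMeasurableSpace (m n : Type*) : MeasurableSpace (Matrix m n ℝ) :=
  inferInstanceAs (MeasurableSpace (m → n → ℝ))

open Classical in
/-- The Rényi divergence of order `α > 1`,
`D_α(P, Q) = (α - 1)⁻¹ * log 𝔼_Q[(dP/dQ) ^ α]`, with values in the extended reals,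
and `+∞` when `P` is not absolutely continuous with respect to `Q`. -/
noncomputable def renyiDiv {Ω : Type*} [MeasurableSpace Ω] (α : ℝ) (P Q : Measure Ω) : EReal :=
  if P ≪ Q then
    (((α - 1)⁻¹ : ℝ) : EReal) * ENNReal.log (∫⁻ x, (P.rnDeriv Q x) ^ α ∂Q)
  else ⊤

/-- The law of a `d × k` matrix with i.i.d. standard normal entries. -/
noncomputable def gaussianMatrix (d k : ℕ) : Measure (Matrix (Fin d) (Fin k) ℝ) :=
  (Measure.pi fun _ : Fin d => Measure.pi fun _ : Fin k => gaussianReal 0 1).map Matrix.of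

/-- The law of `V = v + N`, where `N` has i.i.d. standard normal entries. -/
noncomputable def paramLaw {d k : ℕ} (v : Matrix (Fin d) (Fin k) ℝ) :
    Measure (Matrix (Fin d) (Fin k) ℝ) :=
  (gaussianMatrix d k).map fun N => v + N

/-- The law of the Gram matrix `Vᵀ V`, where `V = v + N`. -/
noncomputable def gramLaw {d k : ℕ} (v : Matrix (Fin d) (Fin k) ℝ) :
    Measure (Matrix (Fin k) (Fin k) ℝ) :=
  (paramLaw v).map fun V => Vᵀ * V

open Filter Topology
open scoped ENNReal

/-! ### Hölder's inequality for Radon–Nikodym derivatives and data processing -/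

/-! The upper bound is data processing: the Gram matrix is a measurable function of the parameter,
and two Gaussian perturbations have divergence `α / 2 * ‖v - w‖ ^ 2` (`renyiDiv_map_le`,
`renyiDiv_paramLaw`).

For the lower bound, the signal is sent to infinity along one matrix unit, with parameters of sizes
`n + 1 + Δ` and `n + 1`. The diagonal Gram entry is then dominated by the square of the signal plus
a term linear in the noise; after centring and rescaling, its laws converge weakly to `N(Δ, 1)` and
`N(0, 1)`, whose divergence is already `α / 2 * Δ ^ 2`. No single pair has to attain this value: it
is enough that Rényi divergence is lower semicontinuous. That is obtained from Hölder's inequality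
`∫ g dP ≤ (∫ (dP/dQ)^α dQ)^(1/α) (∫ g^β dQ)^(1/β)`, in which bounded continuous test functions `g`
pass to the limit and the extremal `g` for the Gaussian pair recovers the exact constant
(`exp_le_of_lintegral_rnDeriv_gramLaw_le`). -/

lemma renyiDiv_of_ac {Ω : Type*} [MeasurableSpace Ω] (α : ℝ) {P Q : Measure Ω} (h : P ≪ Q) :
    renyiDiv α P Q = ENNReal.log ((∫⁻ x, (P.rnDeriv Q x) ^ α ∂Q) ^ (α - 1)⁻¹) := by
  rw [renyiDiv, if_pos h, ENNReal.log_rpow]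

/-- Change of measure followed by Hölder. The density enters only through its `α`-th moment, so the
bound can be tested on functions of a pushforward and survives weak limits. -/
lemma lintegral_le_rnDeriv_rpow_mul {Ω : Type*} [MeasurableSpace Ω] {α β : ℝ}
    (hαβ : α.HolderConjugate β) {P Q : Measure Ω} [SigmaFinite P] [SigmaFinite Q] (h : P ≪ Q)
    {g : Ω → ℝ≥0∞} (hg : Measurable g) :
    ∫⁻ x, g x ∂P ≤
      (∫⁻ x, (P.rnDeriv Q x) ^ α ∂Q) ^ (1 / α) * (∫⁻ x, g x ^ β ∂Q) ^ (1 / β) := by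
  rw [← lintegral_rnDeriv_mul h hg.aemeasurable]
  exact ENNReal.lintegral_mul_le_Lp_mul_Lq Q hαβ (Measure.measurable_rnDeriv P Q).aemeasurable
    hg.aemeasurable

/-- Cancel `a ^ (1 / β)`. Finiteness of `a` is essential: `a = ∞` satisfies the inequality for every
`r > 0`. -/
lemma ENNReal.le_of_le_rpow_mul_rpow {α β : ℝ} (hαβ : α.HolderConjugate β) {a r : ℝ≥0∞}
    (ha : a ≠ ∞) (h : a ≤ r ^ (1 / α) * a ^ (1 / β)) : a ≤ r := by
  rcases eq_or_ne a 0 with rfl | ha0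
  · simp
  have hα : 0 < 1 / α := hαβ.one_div_pos
  have hsum : 1 / α + 1 / β = 1 := by simpa using hαβ.inv_add_inv_eq_one
  have hsplit : a = a ^ (1 / α) * a ^ (1 / β) := by
    rw [← ENNReal.rpow_add _ _ ha0 ha, hsum, ENNReal.rpow_one]
  have h0 : a ^ (1 / β) ≠ 0 := by simp [ENNReal.rpow_eq_zero_iff, ha0, ha]
  have ht : a ^ (1 / β) ≠ ∞ := by simp [ENNReal.rpow_eq_top_iff, ha0, ha]
  have h' : a ^ (1 / α) * a ^ (1 / β) ≤ r ^ (1 / α) * a ^ (1 / β) := hsplit.symm.trans_le h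
  rw [ENNReal.mul_le_mul_iff_left h0 ht] at h'
  exact (ENNReal.rpow_le_rpow_iff hα).1 h'

/-- Test Hölder with `g = ρ ^ (α - 1) ∘ f`, where `ρ` is the density of the images. Since `(α - 1) *
β = α`, the `α`-th moment of `ρ` appears on both sides and can be cancelled. -/
lemma lintegral_rnDeriv_map_rpow_le {Ω Ω' : Type*} [MeasurableSpace Ω] [MeasurableSpace Ω']
    {α : ℝ} (hα : 1 < α) {P Q : Measure Ω} [IsProbabilityMeasure P] [IsProbabilityMeasure Q]
    (h : P ≪ Q) {f : Ω → Ω'} (hf : Measurable f) :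
    ∫⁻ y, ((P.map f).rnDeriv (Q.map f) y) ^ α ∂(Q.map f) ≤ ∫⁻ x, (P.rnDeriv Q x) ^ α ∂Q := by
  have hαβ := Real.HolderConjugate.conjExponent hα
  have hα1 : (α - 1) * α.conjExponent = α := by
    rw [Real.conjExponent]; field_simp [(sub_pos.2 hα).ne']
  have hac : P.map f ≪ Q.map f := h.map hf
  have := Measure.isProbabilityMeasure_map (μ := P) hf.aemeasurable
  have := Measure.isProbabilityMeasure_map (μ := Q) hf.aemeasurable
  set ρ := (P.map f).rnDeriv (Q.map f) with hρ
  have hρm : Measurable ρ := Measure.measurable_rnDeriv _ _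
  -- Truncating `ρ` at `n` makes its moment finite, as the cancellation requires; monotone
  -- convergence removes the truncation afterwards.
  have key (n : ℕ) : ∫⁻ y, (min (ρ y) n) ^ α ∂(Q.map f) ≤ ∫⁻ x, (P.rnDeriv Q x) ^ α ∂Q := by
    have hm : Measurable fun y => min (ρ y) (n : ℝ≥0∞) := hρm.min measurable_const
    apply ENNReal.le_of_le_rpow_mul_rpow hαβ
    · refine ((lintegral_mono fun y => ENNReal.rpow_le_rpow (min_le_right _ _)
        (zero_le_one.trans hα.le)).trans_lt ?_).ne
      simp only [lintegral_const, measure_univ, mul_one]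
      exact ENNReal.rpow_lt_top_of_nonneg (zero_le_one.trans hα.le) (by simp)
    · calc ∫⁻ y, (min (ρ y) n) ^ α ∂(Q.map f)
          ≤ ∫⁻ y, ρ y * (min (ρ y) n) ^ (α - 1) ∂(Q.map f) := by
            refine lintegral_mono fun y => ?_
            have : α = 1 + (α - 1) := by ring
            conv_lhs => rw [this]
            rw [ENNReal.rpow_add_of_nonneg _ _ zero_le_one (sub_pos.2 hα).le, ENNReal.rpow_one]
            exact mul_le_mul_left (min_le_left _ _) _
        _ = ∫⁻ y, (min (ρ y) n) ^ (α - 1) ∂(P.map f) :=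
            lintegral_rnDeriv_mul hac (hm.pow_const _).aemeasurable
        _ = ∫⁻ x, (min (ρ (f x)) n) ^ (α - 1) ∂P := lintegral_map (hm.pow_const _) hf
        _ ≤ _ := lintegral_le_rnDeriv_rpow_mul hαβ h ((hm.comp hf).pow_const _)
        _ = _ := by
            simp_rw [← ENNReal.rpow_mul, hα1]
            rw [lintegral_map (hm.pow_const _) hf]
  refine le_of_tendsto' (lintegral_tendsto_of_tendsto_of_monotone
    (fun n => ((hρm.min measurable_const).pow_const α).aemeasurable)
    (.of_forall fun y m n hmn => ?_) (.of_forall fun y => ?_)) key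
  · exact ENNReal.rpow_le_rpow (min_le_min_left _ (by exact_mod_cast hmn))
      (zero_le_one.trans hα.le)
  · refine (ENNReal.continuous_rpow_const.tendsto _).comp ?_
    simpa using (tendsto_const_nhds (x := ρ y)).min ENNReal.tendsto_nat_nhds_top

/-- **Data processing inequality** for the Rényi divergence. -/
lemma renyiDiv_map_le {Ω Ω' : Type*} [MeasurableSpace Ω] [MeasurableSpace Ω']
    {α : ℝ} (hα : 1 < α) (P Q : Measure Ω) [IsProbabilityMeasure P] [IsProbabilityMeasure Q]
    {f : Ω → Ω'} (hf : Measurable f) :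
    renyiDiv α (P.map f) (Q.map f) ≤ renyiDiv α P Q := by
  by_cases h : P ≪ Q
  · rw [renyiDiv_of_ac α h, renyiDiv_of_ac α (h.map hf)]
    exact ENNReal.log_le_log (ENNReal.rpow_le_rpow (lintegral_rnDeriv_map_rpow_le hα h hf)
      (inv_nonneg.2 (sub_pos.2 hα).le))
  · rw [renyiDiv, renyiDiv, if_neg h]
    exact le_top

/-! ### Products of densities -/

lemma lintegral_pi_fin_prod {n : ℕ} {E : Type*} [MeasurableSpace E] (μ : Fin n → Measure E)
    [∀ i, SigmaFinite (μ i)] {f : Fin n → E → ℝ≥0∞} (hf : ∀ i, Measurable (f i)) :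
    ∫⁻ x, ∏ i, f i (x i) ∂(Measure.pi μ) = ∏ i, ∫⁻ x, f i x ∂(μ i) := by
  induction n with
  | zero => simp
  | succ n ih =>
    rw [← (measurePreserving_piFinSuccAbove μ 0).symm.lintegral_comp_emb
      (MeasurableEquiv.measurableEmbedding _)]
    simp_rw [MeasurableEquiv.piFinSuccAbove_symm_apply, Fin.insertNthEquiv, Fin.prod_univ_succ]
    simp only [Equiv.coe_fn_mk, Fin.insertNth_zero, Fin.cons_zero, Fin.cons_succ,
      Fin.zero_succAbove]
    rw [← ih (fun i => μ i.succ) fun i => hf i.succ]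
    have hm : Measurable fun y : Fin n → E => ∏ i : Fin n, f i.succ (y i) :=
      Finset.measurable_prod _ fun i _ => (hf _).comp (measurable_pi_apply i)
    exact lintegral_prod_mul (hf 0).aemeasurable hm.aemeasurable

lemma pi_withDensity {n : ℕ} {E : Type*} [MeasurableSpace E] (μ : Fin n → Measure E)
    [∀ i, SigmaFinite (μ i)] {f : Fin n → E → ℝ≥0∞} (hf : ∀ i, Measurable (f i))
    [∀ i, SigmaFinite ((μ i).withDensity (f i))] :
    Measure.pi (fun i => (μ i).withDensity (f i)) =
      (Measure.pi μ).withDensity fun x => ∏ i, f i (x i) := by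
  refine Measure.pi_eq fun s hs => ?_
  rw [withDensity_apply _ (MeasurableSet.univ_pi hs),
    ← lintegral_indicator (MeasurableSet.univ_pi hs)]
  -- The indicator of a box is the product of the indicators of its sides, so the integral over the
  -- box factorises.
  have : ((Set.univ.pi s).indicator fun x : Fin n → E => ∏ i, f i (x i)) =
      fun x => ∏ i, (s i).indicator (f i) (x i) := by
    ext x
    by_cases hx : x ∈ Set.univ.pi s
    · rw [Set.indicator_of_mem hx]
      exact Finset.prod_congr rfl fun i _ => (Set.indicator_of_mem (hx i trivial) _).symm
    · rw [Set.indicator_of_notMem hx]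
      simp only [Set.mem_pi, Set.mem_univ, true_implies, not_forall] at hx
      obtain ⟨i, hi⟩ := hx
      exact (Finset.prod_eq_zero (Finset.mem_univ i) (Set.indicator_of_notMem hi _)).symm
  rw [this, lintegral_pi_fin_prod μ fun i => (hf i).indicator (hs i)]
  exact Finset.prod_congr rfl fun i _ => by
    rw [lintegral_indicator (hs i), withDensity_apply _ (hs i)]

/-! ### Gaussian matrices -/

/-- The density of `gaussianReal a 1` with respect to `gaussianReal b 1`. -/
noncomputable def gaussianShiftDensity (a b x : ℝ) : ℝ≥0∞ :=
  ENNReal.ofReal (Real.exp ((a - b) * x - (a ^ 2 - b ^ 2) / 2))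

@[fun_prop]
lemma measurable_gaussianShiftDensity (a b : ℝ) : Measurable (gaussianShiftDensity a b) := by
  unfold gaussianShiftDensity
  fun_prop

lemma gaussianReal_withDensity_shift (a b : ℝ) :
    (gaussianReal b 1).withDensity (gaussianShiftDensity a b) = gaussianReal a 1 := by
  rw [gaussianReal_of_var_ne_zero _ one_ne_zero, gaussianReal_of_var_ne_zero _ one_ne_zero,
    ← withDensity_mul _ (measurable_gaussianPDF _ _) (measurable_gaussianShiftDensity _ _)]
  congr 1
  ext x
  simp only [Pi.mul_apply, gaussianPDF, gaussianPDFReal, gaussianShiftDensity]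
  rw [← ENNReal.ofReal_mul (by positivity), mul_assoc, ← Real.exp_add]
  congr 3
  push_cast
  ring

lemma lintegral_exp_mul_gaussianReal (a t : ℝ) :
    ∫⁻ x, ENNReal.ofReal (Real.exp (t * x)) ∂(gaussianReal a 1) =
      ENNReal.ofReal (Real.exp (a * t + t ^ 2 / 2)) := by
  rw [← ofReal_integral_eq_lintegral_ofReal (integrable_exp_mul_gaussianReal t)
    (.of_forall fun x => (Real.exp_pos _).le)]
  congr 1
  have := mgf_gaussianReal (p := gaussianReal a 1) (X := id) (by simp : _ = gaussianReal a 1) t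
  simpa [mgf] using this

lemma lintegral_gaussianShiftDensity_rpow (α a b : ℝ) :
    ∫⁻ x, gaussianShiftDensity a b x ^ α ∂(gaussianReal b 1) =
      ENNReal.ofReal (Real.exp (α * (α - 1) / 2 * (a - b) ^ 2)) := by
  have (x : ℝ) : gaussianShiftDensity a b x ^ α =
      ENNReal.ofReal (Real.exp (-(α * ((a ^ 2 - b ^ 2) / 2)))) *
        ENNReal.ofReal (Real.exp (α * (a - b) * x)) := by
    rw [gaussianShiftDensity, ENNReal.ofReal_rpow_of_pos (Real.exp_pos _), ← Real.exp_mul,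
      ← ENNReal.ofReal_mul (Real.exp_pos _).le, ← Real.exp_add]
    ring_nf
  simp_rw [this]
  rw [lintegral_const_mul _ (by fun_prop), lintegral_exp_mul_gaussianReal,
    ← ENNReal.ofReal_mul (Real.exp_pos _).le, ← Real.exp_add]
  ring_nf

lemma gaussianReal_map_add_one (a : ℝ) :
    (gaussianReal 0 1).map (fun x => a + x) = gaussianReal a 1 := by
  rw [gaussianReal_map_const_add, zero_add]

/-- The product of Gaussian measures with unit variance and mean `v i j`. -/
noncomputable def gaussianPi {d k : ℕ} (v : Fin d → Fin k → ℝ) : Measure (Fin d → Fin k → ℝ) :=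
  Measure.pi fun i => Measure.pi fun j => gaussianReal (v i j) 1

lemma measurable_matrixOf (d k : ℕ) :
    Measurable (Matrix.of : (Fin d → Fin k → ℝ) → Matrix (Fin d) (Fin k) ℝ) :=
  measurable_id

lemma measurable_matrix_entry {d k : ℕ} (i : Fin d) (j : Fin k) :
    Measurable fun A : Matrix (Fin d) (Fin k) ℝ => A i j :=
  (measurable_pi_apply j).comp (measurable_pi_apply i)

lemma measurable_matrix_iff {d k : ℕ} {Ω : Type*} [MeasurableSpace Ω]
    {f : Ω → Matrix (Fin d) (Fin k) ℝ} (h : ∀ i j, Measurable fun x => f x i j) :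
    Measurable f :=
  measurable_pi_lambda _ fun i => measurable_pi_lambda _ fun j => h i j

lemma measurable_matrix_add {d k : ℕ} (v : Matrix (Fin d) (Fin k) ℝ) :
    Measurable fun N : Matrix (Fin d) (Fin k) ℝ => v + N :=
  measurable_matrix_iff fun i j => (measurable_matrix_entry i j).const_add (v i j)

lemma measurable_gram (d k : ℕ) :
    Measurable fun V : Matrix (Fin d) (Fin k) ℝ => Vᵀ * V := by
  refine measurable_matrix_iff fun i j => ?_
  simp only [Matrix.mul_apply, Matrix.transpose_apply]
  exact Finset.measurable_sum _ fun l _ =>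
    (measurable_matrix_entry l i).mul (measurable_matrix_entry l j)

instance (d k : ℕ) : IsProbabilityMeasure (gaussianMatrix d k) :=
  Measure.isProbabilityMeasure_map (measurable_matrixOf d k).aemeasurable

instance {d k : ℕ} (v : Matrix (Fin d) (Fin k) ℝ) : IsProbabilityMeasure (paramLaw v) :=
  Measure.isProbabilityMeasure_map (measurable_matrix_add v).aemeasurable

instance {d k : ℕ} (v : Matrix (Fin d) (Fin k) ℝ) : IsProbabilityMeasure (gramLaw v) :=
  Measure.isProbabilityMeasure_map (measurable_gram d k).aemeasurable

lemma paramLaw_eq {d k : ℕ} (v : Matrix (Fin d) (Fin k) ℝ) :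
    paramLaw v = (gaussianPi v).map Matrix.of := by
  rw [paramLaw, gaussianMatrix, Measure.map_map (measurable_matrix_add v) (measurable_matrixOf d k)]
  have h : gaussianPi v = (Measure.pi fun _ : Fin d => Measure.pi fun _ : Fin k =>
      gaussianReal 0 1).map fun x i j => v i j + x i j := by
    simp_rw [gaussianPi, ← gaussianReal_map_add_one (v _ _)]
    symm
    have := Measure.pi_map_pi (μ := fun _ : Fin d => Measure.pi fun _ : Fin k => gaussianReal 0 1)
      (f := fun i x j => v i j + x j) fun i =>
        Measurable.aemeasurable (by fun_prop)
    rw [this]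
    congr 1
    ext1 i
    exact Measure.pi_map_pi (μ := fun _ : Fin k => gaussianReal 0 1)
      (f := fun j x => v i j + x) fun j => by fun_prop
  rw [h, Measure.map_map (measurable_matrixOf d k) (by fun_prop)]
  rfl

lemma gaussianPi_withDensity {d k : ℕ} (v w : Fin d → Fin k → ℝ) :
    gaussianPi v = (gaussianPi w).withDensity
      fun x => ∏ i, ∏ j, gaussianShiftDensity (v i j) (w i j) (x i j) := by
  have h1 (i : Fin d) : (Measure.pi fun j => gaussianReal (v i j) 1) =
      (Measure.pi fun j => gaussianReal (w i j) 1).withDensity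
        fun x => ∏ j, gaussianShiftDensity (v i j) (w i j) (x j) := by
    have (j : Fin k) : SigmaFinite ((gaussianReal (w i j) 1).withDensity
        (gaussianShiftDensity (v i j) (w i j))) := by
      rw [gaussianReal_withDensity_shift]; infer_instance
    rw [← pi_withDensity _ fun j => measurable_gaussianShiftDensity _ _]
    simp_rw [gaussianReal_withDensity_shift]
  have (i : Fin d) : SigmaFinite ((Measure.pi fun j => gaussianReal (w i j) 1).withDensity
        fun x => ∏ j, gaussianShiftDensity (v i j) (w i j) (x j)) := by
    rw [← h1]; infer_instance
  have h2 := pi_withDensity (fun i => Measure.pi fun j => gaussianReal (w i j) 1)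
    (f := fun i x => ∏ j, gaussianShiftDensity (v i j) (w i j) (x j)) fun i => by fun_prop
  simp_rw [← h1] at h2
  exact h2

lemma paramLaw_withDensity {d k : ℕ} (v w : Matrix (Fin d) (Fin k) ℝ) :
    paramLaw v = (paramLaw w).withDensity
      fun x => ∏ i, ∏ j, gaussianShiftDensity (v i j) (w i j) (x i j) := by
  -- `Matrix.of` is the identity map and matrices carry the product σ-algebra, so both measures live
  -- on definitionally the same space.
  have h (u : Matrix (Fin d) (Fin k) ℝ) : paramLaw u = gaussianPi u := by
    rw [paramLaw_eq]; exact Measure.map_id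
  rw [h, h]
  exact gaussianPi_withDensity v w

lemma lintegral_gaussianPi_rpow {d k : ℕ} (α : ℝ) (v w : Fin d → Fin k → ℝ) :
    ∫⁻ x, ∏ i, ∏ j, gaussianShiftDensity (v i j) (w i j) (x i j) ^ α ∂(gaussianPi w) =
      ENNReal.ofReal (Real.exp (α * (α - 1) / 2 * ∑ i, ∑ j, (v i j - w i j) ^ 2)) := by
  refine (lintegral_pi_fin_prod (fun i => Measure.pi fun j => gaussianReal (w i j) 1)
    (f := fun i x => ∏ j, gaussianShiftDensity (v i j) (w i j) (x j) ^ α) fun i => by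
      fun_prop).trans ?_
  have (i : Fin d) := lintegral_pi_fin_prod (f := fun j x =>
    gaussianShiftDensity (v i j) (w i j) x ^ α) (fun j => gaussianReal (w i j) 1) fun j => by
      fun_prop
  simp_rw [this, lintegral_gaussianShiftDensity_rpow, Finset.mul_sum, Real.exp_sum]
  rw [ENNReal.ofReal_prod_of_nonneg fun i _ => Finset.prod_nonneg fun j _ => (Real.exp_pos _).le]
  exact Finset.prod_congr rfl fun i _ =>
    (ENNReal.ofReal_prod_of_nonneg fun j _ => (Real.exp_pos _).le).symm

lemma lintegral_paramLaw_rpow {d k : ℕ} {α : ℝ} (hα : 0 ≤ α) (v w : Matrix (Fin d) (Fin k) ℝ) :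
    ∫⁻ x, (∏ i, ∏ j, gaussianShiftDensity (v i j) (w i j) (x i j)) ^ α ∂(paramLaw w) =
      ENNReal.ofReal (Real.exp (α * (α - 1) / 2 * ‖v - w‖ ^ 2)) := by
  have hm : Measurable fun x : Matrix (Fin d) (Fin k) ℝ =>
      (∏ i, ∏ j, gaussianShiftDensity (v i j) (w i j) (x i j)) ^ α :=
    (Finset.measurable_prod _ fun i _ => Finset.measurable_prod _ fun j _ =>
      (measurable_gaussianShiftDensity _ _).comp (measurable_matrix_entry i j)).pow_const α
  have hn : ‖v - w‖ ^ 2 = ∑ i, ∑ j, (v i j - w i j) ^ 2 := by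
    rw [Matrix.frobenius_norm_def, ← Real.sqrt_eq_rpow, Real.sq_sqrt (by positivity)]
    simp
  rw [paramLaw_eq, lintegral_map hm (measurable_matrixOf d k), hn]
  simp_rw [← ENNReal.prod_rpow_of_nonneg hα, Matrix.of_apply]
  exact lintegral_gaussianPi_rpow α v w

/-- The Rényi divergence of two Gaussian perturbations. -/
lemma renyiDiv_paramLaw {d k : ℕ} {α : ℝ} (hα : 1 < α) (v w : Matrix (Fin d) (Fin k) ℝ) :
    renyiDiv α (paramLaw v) (paramLaw w) = ((α / 2 * ‖v - w‖ ^ 2 : ℝ) : EReal) := by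
  have hwd := paramLaw_withDensity v w
  have hm : Measurable fun x : Matrix (Fin d) (Fin k) ℝ =>
      ∏ i, ∏ j, gaussianShiftDensity (v i j) (w i j) (x i j) :=
    Finset.measurable_prod _ fun i _ => Finset.measurable_prod _ fun j _ =>
      (measurable_gaussianShiftDensity _ _).comp (measurable_matrix_entry i j)
  have hac : paramLaw v ≪ paramLaw w := by
    rw [hwd]; exact withDensity_absolutelyContinuous _ _
  have hrn := Measure.rnDeriv_withDensity (paramLaw w) hm
  rw [← hwd] at hrn
  have hα1 := sub_pos.2 hα
  rw [renyiDiv, if_pos hac, lintegral_congr_ae (hrn.mono fun x hx => congrArg (· ^ α) hx),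
    lintegral_paramLaw_rpow (zero_le_one.trans hα.le), ENNReal.log_ofReal_of_pos (Real.exp_pos _),
    Real.log_exp, ← EReal.coe_mul]
  congr 1
  field_simp

/-! ### Gram matrices of large rank-one parameters -/

lemma gaussianMatrix_map_entry {d k : ℕ} (i : Fin d) (j : Fin k) :
    (gaussianMatrix d k).map (fun N : Matrix (Fin d) (Fin k) ℝ => N i j) = gaussianReal 0 1 := by
  rw [gaussianMatrix, Measure.map_map (measurable_matrix_entry i j) (measurable_matrixOf d k)]
  exact ((measurePreserving_eval (fun _ : Fin k => gaussianReal 0 1) j).comp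
    (measurePreserving_eval
      (fun _ : Fin d => Measure.pi fun _ : Fin k => gaussianReal 0 1) i)).map_eq

lemma gram_single_add_apply {d k : ℕ} (i : Fin d) (j : Fin k) (s : ℝ)
    (N : Matrix (Fin d) (Fin k) ℝ) :
    ((Matrix.single i j s + N)ᵀ * (Matrix.single i j s + N)) j j =
      s ^ 2 + 2 * s * N i j + ∑ l, N l j ^ 2 := by
  have h (l : Fin d) : (Matrix.single i j s + N) l j * (Matrix.single i j s + N) l j =
      (if l = i then s ^ 2 + 2 * s * N i j else 0) + N l j ^ 2 := by
    by_cases hl : l = i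
    · subst hl
      simp only [Matrix.add_apply, Matrix.single_apply_same, if_true]
      ring
    · simp only [Matrix.add_apply, Matrix.single_apply, Ne.symm hl, hl, false_and, if_false]
      ring
  simp_rw [Matrix.mul_apply, Matrix.transpose_apply, h, Finset.sum_add_distrib]
  simp

/-- The `(j, j)` entry of a Gram matrix, normalised at signal strength `n + 1`. -/
noncomputable def normalizedEntry {k : ℕ} (j : Fin k) (n : ℕ) (G : Matrix (Fin k) (Fin k) ℝ) : ℝ :=
  (G j j - (n + 1) ^ 2) / (2 * (n + 1))

lemma measurable_normalizedEntry {k : ℕ} (j : Fin k) (n : ℕ) :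
    Measurable (normalizedEntry j n) :=
  ((measurable_matrix_entry j j).sub_const _).div_const _

/-- With `s = n + 1 + δ`, both `s ^ 2 - (n + 1) ^ 2` and the cross term `2 * s * N i j` grow
linearly in `n`, and they leave `δ + N i j` after division by `2 * (n + 1)`. The quadratic noise
does not grow and vanishes in the limit. -/
lemma tendsto_normalizedEntry {d k : ℕ} (i : Fin d) (j : Fin k) (δ : ℝ)
    (N : Matrix (Fin d) (Fin k) ℝ) :
    Tendsto (fun n : ℕ => normalizedEntry j n
      ((Matrix.single i j (n + 1 + δ) + N)ᵀ * (Matrix.single i j (n + 1 + δ) + N)))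
      atTop (𝓝 (δ + N i j)) := by
  have h (n : ℕ) : normalizedEntry j n
      ((Matrix.single i j (n + 1 + δ) + N)ᵀ * (Matrix.single i j (n + 1 + δ) + N)) =
      δ + N i j + (δ ^ 2 + 2 * δ * N i j + ∑ l, N l j ^ 2) / 2 * (1 / ((n : ℝ) + 1)) := by
    rw [normalizedEntry, gram_single_add_apply]
    have : (n : ℝ) + 1 ≠ 0 := by positivity
    field_simp
    ring
  simp_rw [h]
  simpa using (tendsto_one_div_add_atTop_nhds_zero_nat.const_mul
    ((δ ^ 2 + 2 * δ * N i j + ∑ l, N l j ^ 2) / 2)).const_add (δ + N i j)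

/-- Weak convergence to `N(δ, 1)`. All the laws are images of the same noise, so pointwise
convergence and dominated convergence suffice. -/
lemma tendsto_lintegral_gramLaw_single {d k : ℕ} (i : Fin d) (j : Fin k) (δ : ℝ) {F : ℝ → ℝ≥0∞}
    (hF : Continuous F) {C : ℝ≥0∞} (hC : C ≠ ∞) (hFC : ∀ x, F x ≤ C) :
    Tendsto (fun n : ℕ => ∫⁻ G, F (normalizedEntry j n G)
        ∂(gramLaw (Matrix.single i j (n + 1 + δ) : Matrix (Fin d) (Fin k) ℝ)))
      atTop (𝓝 (∫⁻ x, F x ∂(gaussianReal δ 1))) := by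
  have hm (n : ℕ) : Measurable fun G : Matrix (Fin k) (Fin k) ℝ => F (normalizedEntry j n G) :=
    hF.measurable.comp (measurable_normalizedEntry j n)
  have hg := measurable_gram d k
  have hlim : ∫⁻ x, F x ∂(gaussianReal δ 1) =
      ∫⁻ N, F (δ + N i j) ∂(gaussianMatrix d k) := by
    rw [← gaussianReal_map_add_one, lintegral_map hF.measurable (by fun_prop),
      ← gaussianMatrix_map_entry i j]
    exact lintegral_map (hF.measurable.comp (measurable_const_add δ)) (measurable_matrix_entry i j)
  have hpre (n : ℕ) : ∫⁻ G, F (normalizedEntry j n G)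
        ∂(gramLaw (Matrix.single i j (n + 1 + δ) : Matrix (Fin d) (Fin k) ℝ)) =
      ∫⁻ N, F (normalizedEntry j n ((Matrix.single i j (n + 1 + δ) + N)ᵀ *
        (Matrix.single i j (n + 1 + δ) + N))) ∂(gaussianMatrix d k) := by
    rw [gramLaw, lintegral_map (hm n) hg, paramLaw]
    exact lintegral_map ((hm n).comp hg) (measurable_matrix_add _)
  rw [hlim]
  simp_rw [hpre]
  refine tendsto_lintegral_of_dominated_convergence (fun _ => C) (fun n => ?_)
    (fun n => .of_forall fun N => hFC _) (by simpa using hC) (.of_forall fun N => ?_)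
  · exact (hm n).comp (hg.comp (measurable_matrix_add _))
  · exact (hF.tendsto _).comp (tendsto_normalizedEntry i j δ N)

/-- Lower semicontinuity along the weak limit. Writing `n + 1 + 0` makes both families instances of
one limit lemma, with `δ = Δ` and `δ = 0`. -/
lemma exp_le_of_lintegral_rnDeriv_gramLaw_le {d k : ℕ} (i : Fin d) (j : Fin k) {α : ℝ}
    (hα : 1 < α) (Δ : ℝ) {M : ℝ≥0∞} (hM : M ≠ ∞)
    (h : ∀ n : ℕ,
      gramLaw (Matrix.single i j (n + 1 + Δ) : Matrix (Fin d) (Fin k) ℝ) ≪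
        gramLaw (Matrix.single i j (n + 1 + 0) : Matrix (Fin d) (Fin k) ℝ) ∧
      ∫⁻ G, ((gramLaw (Matrix.single i j (n + 1 + Δ) : Matrix (Fin d) (Fin k) ℝ)).rnDeriv
        (gramLaw (Matrix.single i j (n + 1 + 0) : Matrix (Fin d) (Fin k) ℝ)) G) ^ α
        ∂(gramLaw (Matrix.single i j (n + 1 + 0) : Matrix (Fin d) (Fin k) ℝ)) ≤ M) :
    ENNReal.ofReal (Real.exp (α * (α - 1) / 2 * Δ ^ 2)) ≤ M := by
  have hαβ := Real.HolderConjugate.conjExponent hα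
  set β := α.conjExponent with hβ
  have hα1 : (α - 1) * β = α := by
    rw [hβ, Real.conjExponent]; field_simp [(sub_pos.2 hα).ne']
  have hα0 : 0 < 1 / α := hαβ.one_div_pos
  have hβ0 : 0 < 1 / β := hαβ.symm.one_div_pos
  have hβpos : 0 ≤ β := hαβ.symm.nonneg
  -- Up to a constant factor, this is the density of `N(Δ, 1)` with respect to `N(0, 1)` raised to
  -- the power `α - 1`: the equality case of Hölder. It is unbounded, hence the truncations at `m`
  -- before passing to the limit in `n`.
  let e : ℝ → ℝ≥0∞ := fun x => ENNReal.ofReal (Real.exp ((α - 1) * Δ * x))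
  have he : Continuous e := ENNReal.continuous_ofReal.comp (by fun_prop)
  have hc (m : ℕ) : Continuous fun x => min (e x) (m : ℝ≥0∞) := he.min continuous_const
  have trunc (m : ℕ) : ∫⁻ x, min (e x) m ∂(gaussianReal Δ 1) ≤
      M ^ (1 / α) * (∫⁻ x, e x ^ β ∂(gaussianReal 0 1)) ^ (1 / β) := by
    have hl := tendsto_lintegral_gramLaw_single i j Δ (hc m) (ENNReal.natCast_ne_top m)
      fun x => min_le_right _ _
    have hr := tendsto_lintegral_gramLaw_single i j 0
      ((ENNReal.continuous_rpow_const (y := β)).comp (hc m))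
      (ENNReal.rpow_ne_top_of_nonneg hβpos (ENNReal.natCast_ne_top m))
      fun x => ENNReal.rpow_le_rpow (min_le_right _ _) hβpos
    have hr' := ENNReal.Tendsto.const_mul (a := M ^ (1 / α))
      ((ENNReal.continuous_rpow_const (y := 1 / β)).tendsto _ |>.comp hr)
      (.inr (ENNReal.rpow_ne_top_of_nonneg hα0.le hM))
    refine (le_of_tendsto_of_tendsto' hl hr' fun n => ?_).trans ?_
    · refine (lintegral_le_rnDeriv_rpow_mul hαβ (h n).1
        ((hc m).measurable.comp (measurable_normalizedEntry j n))).trans ?_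
      exact mul_le_mul_left (ENNReal.rpow_le_rpow (h n).2 hα0.le) _
    · exact mul_le_mul_right (ENNReal.rpow_le_rpow (lintegral_mono fun x =>
        ENNReal.rpow_le_rpow (min_le_left _ _) hβpos) hβ0.le) _
  have full : ∫⁻ x, e x ∂(gaussianReal Δ 1) ≤
      M ^ (1 / α) * (∫⁻ x, e x ^ β ∂(gaussianReal 0 1)) ^ (1 / β) := by
    refine le_of_tendsto' (lintegral_tendsto_of_tendsto_of_monotone
      (fun m => (hc m).measurable.aemeasurable)
      (.of_forall fun y m n hmn => min_le_min_left _ (by exact_mod_cast hmn))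
      (.of_forall fun y => ?_)) trunc
    simpa using (tendsto_const_nhds (x := e y)).min ENNReal.tendsto_nat_nhds_top
  have hright : (∫⁻ x, e x ^ β ∂(gaussianReal 0 1)) ^ (1 / β) =
      ENNReal.ofReal (Real.exp (α * (α - 1) / 2 * Δ ^ 2)) := by
    have (x : ℝ) : e x ^ β = ENNReal.ofReal (Real.exp (α * Δ * x)) := by
      rw [ENNReal.ofReal_rpow_of_pos (Real.exp_pos _), ← Real.exp_mul]
      congr 2
      linear_combination (Δ * x) * hα1
    simp_rw [this]
    rw [lintegral_exp_mul_gaussianReal, ENNReal.ofReal_rpow_of_pos (Real.exp_pos _),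
      ← Real.exp_mul]
    congr 2
    rw [hβ, Real.conjExponent]
    field_simp
    ring
  have hleft : ∫⁻ x, e x ∂(gaussianReal Δ 1) =
      ENNReal.ofReal (Real.exp (α * (α - 1) / 2 * Δ ^ 2)) ^ (1 / α) *
        ENNReal.ofReal (Real.exp (α * (α - 1) / 2 * Δ ^ 2)) := by
    rw [lintegral_exp_mul_gaussianReal, ENNReal.ofReal_rpow_of_pos (Real.exp_pos _),
      ← Real.exp_mul, ← ENNReal.ofReal_mul (Real.exp_pos _).le, ← Real.exp_add]
    congr 2
    field_simp
    ring
  -- With `K = exp (α * (α - 1) / 2 * Δ ^ 2)`, the inequality reads `K ^ (1 / α) * K ≤ M ^ (1 / α) *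
  -- K`.
  rw [hright, hleft, ENNReal.mul_le_mul_iff_left (by simp [Real.exp_pos]) ENNReal.ofReal_ne_top,
    ENNReal.rpow_le_rpow_iff hα0] at full
  exact full

lemma frobenius_norm_single {d k : ℕ} (i : Fin d) (j : Fin k) (s : ℝ) :
    ‖(Matrix.single i j s : Matrix (Fin d) (Fin k) ℝ)‖ = |s| := by
  have h (l : Fin d) (m : Fin k) :
      ‖(Matrix.single i j s : Matrix (Fin d) (Fin k) ℝ) l m‖ ^ (2 : ℝ) =
      if i = l then (if j = m then s ^ 2 else 0) else 0 := by
    by_cases hl : i = l <;> by_cases hm : j = m <;> simp [hl, hm]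
  rw [Matrix.frobenius_norm_def]
  have hsum : ∑ l, ∑ m, ‖(Matrix.single i j s : Matrix (Fin d) (Fin k) ℝ) l m‖ ^ (2 : ℝ) =
      s ^ 2 := by
    simp_rw [h]
    simp
  rw [hsum, ← Real.sqrt_eq_rpow, Real.sqrt_sq_eq_abs]

theorem mainTheorem5 (d k : ℕ) (hd : 0 < d) (hk : 0 < k) (α : ℝ) (hα : 1 < α)
    (Δ : ℝ) (hΔ : 0 < Δ) :
    (⨆ (v : Matrix (Fin d) (Fin k) ℝ) (w : Matrix (Fin d) (Fin k) ℝ) (_ : ‖v - w‖ ≤ Δ),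
        renyiDiv α (gramLaw v) (gramLaw w)) =
      (⨆ (v : Matrix (Fin d) (Fin k) ℝ) (w : Matrix (Fin d) (Fin k) ℝ) (_ : ‖v - w‖ ≤ Δ),
        renyiDiv α (paramLaw v) (paramLaw w)) ∧
    ∀ v₀ w₀ : Matrix (Fin d) (Fin k) ℝ, ‖v₀ - w₀‖ = Δ →
      (⨆ (v : Matrix (Fin d) (Fin k) ℝ) (w : Matrix (Fin d) (Fin k) ℝ) (_ : ‖v - w‖ ≤ Δ),
        renyiDiv α (gramLaw v) (gramLaw w)) =
      renyiDiv α (paramLaw v₀) (paramLaw w₀) := by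
  let i : Fin d := ⟨0, hd⟩
  let j : Fin k := ⟨0, hk⟩
  have hα1 : 0 < α - 1 := sub_pos.2 hα
  have hnorm (s t : ℝ) :
      ‖(Matrix.single i j s : Matrix (Fin d) (Fin k) ℝ) - Matrix.single i j t‖ = |s - t| := by
    rw [← frobenius_norm_single i j (s - t)]
    congr 1
    ext l m
    simp only [Matrix.sub_apply, Matrix.single_apply]
    split_ifs <;> simp
  have gram_le_param (v w : Matrix (Fin d) (Fin k) ℝ) :
      renyiDiv α (gramLaw v) (gramLaw w) ≤ renyiDiv α (paramLaw v) (paramLaw w) :=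
    renyiDiv_map_le hα _ _ (measurable_gram d k)
  have param_le : (⨆ (v : Matrix (Fin d) (Fin k) ℝ) (w : Matrix (Fin d) (Fin k) ℝ)
      (_ : ‖v - w‖ ≤ Δ), renyiDiv α (paramLaw v) (paramLaw w)) ≤ ((α / 2 * Δ ^ 2 : ℝ) : EReal) := by
    refine iSup_le fun v => iSup_le fun w => iSup_le fun h => ?_
    rw [renyiDiv_paramLaw hα, EReal.coe_le_coe_iff]
    gcongr
  have gram_le : (⨆ (v : Matrix (Fin d) (Fin k) ℝ) (w : Matrix (Fin d) (Fin k) ℝ)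
      (_ : ‖v - w‖ ≤ Δ), renyiDiv α (gramLaw v) (gramLaw w)) ≤
      ⨆ (v : Matrix (Fin d) (Fin k) ℝ) (w : Matrix (Fin d) (Fin k) ℝ)
      (_ : ‖v - w‖ ≤ Δ), renyiDiv α (paramLaw v) (paramLaw w) :=
    iSup_mono fun v => iSup_mono fun w => iSup_mono fun _ => gram_le_param v w
  have le_gram : ((α / 2 * Δ ^ 2 : ℝ) : EReal) ≤ ⨆ (v : Matrix (Fin d) (Fin k) ℝ)
      (w : Matrix (Fin d) (Fin k) ℝ) (_ : ‖v - w‖ ≤ Δ), renyiDiv α (gramLaw v) (gramLaw w) := by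
    by_contra! hlt
    -- A real `s` strictly between the two sides bounds every divergence in the family by a finite
    -- number; this gives absolute continuity and the uniform moment bound `exp ((α - 1) * s)`.
    obtain ⟨s, hs, hsc⟩ := EReal.lt_iff_exists_real_btwn.1 hlt
    rw [EReal.coe_lt_coe_iff] at hsc
    have hle := exp_le_of_lintegral_rnDeriv_gramLaw_le i j hα Δ
      (M := ENNReal.ofReal (Real.exp ((α - 1) * s))) ENNReal.ofReal_ne_top fun n => by
      have hn : renyiDiv α
          (gramLaw (Matrix.single i j (n + 1 + Δ) : Matrix (Fin d) (Fin k) ℝ))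
          (gramLaw (Matrix.single i j (n + 1 + 0) : Matrix (Fin d) (Fin k) ℝ)) ≤ s := by
        refine le_trans ?_ hs.le
        refine le_iSup_of_le _ (le_iSup_of_le _ (le_iSup_of_le ?_ le_rfl))
        rw [hnorm]
        simp [abs_of_pos hΔ]
      have hac : gramLaw (Matrix.single i j (n + 1 + Δ) : Matrix (Fin d) (Fin k) ℝ) ≪
          gramLaw (Matrix.single i j (n + 1 + 0) : Matrix (Fin d) (Fin k) ℝ) := by
        by_contra hac
        rw [renyiDiv, if_neg hac] at hn
        exact EReal.coe_ne_top s (top_le_iff.1 hn)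
      refine ⟨hac, ?_⟩
      have hsM : (s : EReal) =
          ENNReal.log (ENNReal.ofReal (Real.exp ((α - 1) * s)) ^ (α - 1)⁻¹) := by
        rw [ENNReal.ofReal_rpow_of_pos (Real.exp_pos _), ← Real.exp_mul,
          ENNReal.log_ofReal_of_pos (Real.exp_pos _), Real.log_exp]
        congr 1
        field_simp
      rwa [renyiDiv_of_ac α hac, hsM, ENNReal.log_le_log_iff,
        ENNReal.rpow_le_rpow_iff (inv_pos.2 hα1)] at hn
    rw [ENNReal.ofReal_le_ofReal_iff (Real.exp_pos _).le, Real.exp_le_exp] at hle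
    -- `hle` gives `α * (α - 1) / 2 * Δ ^ 2 ≤ (α - 1) * s`, contradicting `s < α / 2 * Δ ^ 2` since
    -- `α - 1 > 0`.
    nlinarith
  have gram_eq := le_antisymm (gram_le.trans param_le) le_gram
  refine ⟨le_antisymm gram_le (param_le.trans le_gram), fun v₀ w₀ h => ?_⟩
  rw [gram_eq, renyiDiv_paramLaw hα, h]
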